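/- Let $n\ge 1$, let $\Omega\subseteq\mathbb{R}^n$ be open and bounded with Lipschitz boundary, and let $p\in[1,\infty)$ with $p\le\frac{n}{n-1}$ (where $\frac{n}{n-1}:=\infty$ if $n=1$). Write $\|\cdot\|_q$ for the norm of $L^q(\Omega)$, and let $C_{BV}$ be the embedding constant of $W^{1,1}_0(\Omega)$ in $L^{n/(n-1)}(\Omega)$, i.e. the smallest constant $C\ge 0$ such that $$\|v\|_{\frac{n}{n-1}}\le C\,\|Dv\|_1\quad\text{for all } v\in W^{1,1}_0(\Omega).$$ For $u\in BV(\Omega)$ let $\mathcal{E}_{TV}(u):=\int_{\mathbb{R}^n}\mathrm{d}|Du|$ be the total variation on $\mathbb{R}^n$ of the extension of $u$ by zero outside $\Omega$. Then, for every $u\in BV(\Omega)$, one has $\mathcal{E}_{TV}(u)<\infty$ and $$\|u\|_p^p\le C_{BV}^{(p-1)n}\,\|u\|_1^{\,n-(n-1)p}\,\mathcal{E}_{TV}(u)^{(p-1)n}.$$ If in addition $p\le\frac{n+1}{n}$, then, for every $u\in BV(\Omega)$, $$\|u\|_p^p\le C_{BV}^{(p-1)n}\,\|u\|_1^{\,n-(n-1)p}\,\big(\mathcal{E}_{TV}(u)+1\big).$$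 Here $0^0:=1$. -/

import Mathlib

open MeasureTheory Filter Topology
open scoped ENNReal NNReal ContDiff

noncomputable section

namespace BVEstimate

/-- `ℝⁿ` with the Euclidean norm. -/
abbrev Space (n : ℕ) : Type := EuclideanSpace ℝ (Fin n)

/-- The exponent `n / (n - 1)`, which is `∞` for `n = 1`. -/
def critExponent (n : ℕ) : ℝ≥0∞ := (n : ℝ≥0∞) / ((n : ℝ≥0∞) - 1)

/-- `φ ∈ C_c^∞(U; F)`: smooth on the whole space, with compact support contained in `U`. -/
structure IsTestFunction {n : ℕ} {F : Type*} [NormedAddCommGroup F] [NormedSpace ℝ F]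
    (U : Set (Space n)) (φ : Space n → F) : Prop where
  smooth : ContDiff ℝ ∞ φ
  compact : HasCompactSupport φ
  supp : tsupport φ ⊆ U

/-- The divergence `∑ᵢ ∂ᵢ φᵢ` of a vector field. -/
def divergence {n : ℕ} (φ : Space n → Space n) (x : Space n) : ℝ :=
  ∑ i, (fderiv ℝ φ x (EuclideanSpace.single i 1)) i

/-- The total variation `|Df|(U) = ∫_U d|Df|`, i.e. the supremum of `∫_U f div φ` over
all `φ ∈ C_c^∞(U; ℝⁿ)` with `|φ| ≤ 1` pointwise (with value `∞` allowed). -/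
def totalVariation {n : ℕ} (U : Set (Space n)) (f : Space n → ℝ) : ℝ≥0∞ :=
  ⨆ (φ : Space n → Space n) (_ : IsTestFunction U φ) (_ : ∀ x, ‖φ x‖ ≤ 1),
    ENNReal.ofReal (∫ x in U, f x * divergence φ x)

/-- `u ∈ BV(Ω)`: `u ∈ L¹(Ω)` with finite total variation in `Ω`. Only the values of `u` on
`Ω` matter. -/
structure MemBV {n : ℕ} (Ω : Set (Space n)) (u : Space n → ℝ) : Prop where
  memLp : MemLp u 1 (volume.restrict Ω)
  variation_lt_top : totalVariation Ω u < ⊤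

/-- `E_TV(u) = ∫_{ℝⁿ} d|Du|`, where `u` is extended by zero outside `Ω`. -/
def energyTV {n : ℕ} (Ω : Set (Space n)) (u : Space n → ℝ) : ℝ≥0∞ :=
  totalVariation Set.univ (Ω.indicator u)

/-- `Ω` has Lipschitz boundary: near each boundary point, in suitable orthonormal coordinates
with last direction `e`, the set `Ω` is the strict supergraph of a Lipschitz function `γ` of the
component `y - ⟪e, y⟫ e` orthogonal to `e`. (A Lipschitz function on the hyperplane
orthogonal to `e` is the same as the restriction to it of a Lipschitz function on `ℝⁿ`.) -/
def HasLipschitzBoundary {n : ℕ} (Ω : Set (Space n)) : Prop :=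
  ∀ x ∈ frontier Ω, ∃ (r : ℝ) (e : Space n) (K : ℝ≥0) (γ : Space n → ℝ),
    0 < r ∧ ‖e‖ = 1 ∧ LipschitzWith K γ ∧
      ∀ y ∈ Metric.ball x r, y ∈ Ω ↔ γ (y - inner ℝ e y • e) < inner ℝ e y

/-- `g` is the weak gradient of `v` in `Ω`. -/
def HasWeakGradient {n : ℕ} (Ω : Set (Space n)) (v : Space n → ℝ) (g : Space n → Space n) :
    Prop :=
  ∀ φ : Space n → ℝ, IsTestFunction Ω φ → ∀ i : Fin n,
    ∫ x in Ω, v x * fderiv ℝ φ x (EuclideanSpace.single i 1) = - ∫ x in Ω, g x i * φ x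

/-- `v ∈ W₀^{1,1}(Ω)` with weak gradient `Dv = g`: `v` and `g` are integrable on `Ω`, `g` is the
weak gradient of `v`, and `v` lies in the `W^{1,1}(Ω)`-closure of `C_c^∞(Ω)`. -/
structure MemW011 {n : ℕ} (Ω : Set (Space n)) (v : Space n → ℝ) (g : Space n → Space n) :
    Prop where
  memLp : MemLp v 1 (volume.restrict Ω)
  memLp_grad : MemLp g 1 (volume.restrict Ω)
  weakGradient : HasWeakGradient Ω v g
  approx : ∃ φ : ℕ → Space n → ℝ, (∀ k, IsTestFunction Ω (φ k)) ∧
    Tendsto (fun k => eLpNorm (φ k - v) 1 (volume.restrict Ω)) atTop (𝓝 0) ∧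
    Tendsto (fun k => eLpNorm (fun x => gradient (φ k) x - g x) 1 (volume.restrict Ω))
      atTop (𝓝 0)

/-- The embedding constant `C_BV` of `W₀^{1,1}(Ω)` (with norm `‖Dv‖₁`) in `L^{n/(n-1)}(Ω)`:
the smallest `C` with `‖v‖_{n/(n-1)} ≤ C ‖Dv‖₁` for all `v ∈ W₀^{1,1}(Ω)`. -/
def embeddingConst {n : ℕ} (Ω : Set (Space n)) : ℝ≥0 :=
  sInf {C : ℝ≥0 | ∀ (v : Space n → ℝ) (g : Space n → Space n), MemW011 Ω v g →
    eLpNorm v (critExponent n) (volume.restrict Ω) ≤ C * eLpNorm g 1 (volume.restrict Ω)}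

end BVEstimate

end

namespace BVEstimate

/-! The estimate is Hölder interpolation between `L¹` and the critical exponent
(`eLpNorm_rpow_le_interpolation`), combined with the Sobolev bound `‖u‖_{n/(n-1)} ≤ C_BV · E_TV(u)`.
The second estimate follows because then `(p - 1) n ≤ 1`.

For the Sobolev bound (`eLpNorm_le_embeddingConst_mul_energyTV`) the zero extension is mollified.
Mollifications are averages of translates, so they do not increase the total variation, which for a
test function dominates `∫ |∇v|`; Fatou's lemma passes to the limit. The mollifications may leak out
of `Ω`, but the inequality is invariant under translation and dilation. Since a nonempty `Ω`
contains a ball, its constant serves all test functions on `ℝⁿ` (`eLpNorm_le_embeddingConst_mul`).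

Finiteness of the energy (`energyTV_lt_top`) reduces to local bounds by a partition of unity. At the
boundary no trace theorem is used. A test field `ψ` is cut off by `χ` vanishing near the graph, and
the dangerous term is `∇χ · ψ`. The cutoffs of `exists_cutoff` increase along a cone around `e`, so
`|∇χ · ψ| ≤ C ∂ₑχ`. The primitive `W` of `∇χ · ψ` along `e` is therefore bounded by `C`, since `χ`
gains at most 1 along a line. With a bump `η`, the field `χ ψ - W η e` is admissible in `Ω` up to
the factor `1 + C`, and its divergence is `χ div ψ` minus the bounded term `W ∂ₑη`. -/

/-! ### Lipschitz supergraphs and monotone cutoffs -/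

/-- The strict supergraph of `γ` in the direction `e`. -/
def supergraph {n : ℕ} (e : Space n) (γ : Space n → ℝ) : Set (Space n) :=
  {y | γ (y - inner ℝ e y • e) < inner ℝ e y}

lemma isOpen_supergraph {n : ℕ} {e : Space n} {γ : Space n → ℝ} (hγ : Continuous γ) :
    IsOpen (supergraph e γ) :=
  isOpen_lt (by fun_prop) (by fun_prop)

/-- The graph rises by at most `K` times the horizontal part of `w`, so a step climbing at least
that much stays above it. -/
lemma add_mem_supergraph {n : ℕ} {e : Space n} {γ : Space n → ℝ} {K : ℝ≥0}
    (hγ : LipschitzWith K γ) {y w : Space n} (hy : y ∈ supergraph e γ)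
    (hw : K * ‖w - inner ℝ e w • e‖ ≤ inner ℝ e w) : y + w ∈ supergraph e γ := by
  simp only [supergraph, Set.mem_ofPred_eq, inner_add_right] at hy ⊢
  have h := hγ.dist_le_mul (y + w - (inner ℝ e y + inner ℝ e w) • e) (y - inner ℝ e y • e)
  rw [dist_eq_norm, dist_eq_norm, Real.norm_eq_abs,
    show y + w - (inner ℝ e y + inner ℝ e w) • e - (y - inner ℝ e y • e)
      = w - inner ℝ e w • e by module] at h
  have := le_abs_self (γ (y + w - (inner ℝ e y + inner ℝ e w) • e) - γ (y - inner ℝ e y • e))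
  linarith

/-- Cone condition with a crude constant: `w` lowers the height by at most `‖w‖`, and its horizontal
part has norm at most `2‖w‖`. -/
lemma smul_add_mem_supergraph {n : ℕ} {e : Space n} (he : ‖e‖ = 1) {γ : Space n → ℝ} {K : ℝ≥0}
    (hγ : LipschitzWith K γ) {y w : Space n} (hy : y ∈ supergraph e γ) {c : ℝ}
    (hw : (1 + 2 * K) * ‖w‖ ≤ c) : y + (c • e + w) ∈ supergraph e γ := by
  apply add_mem_supergraph hγ hy
  have hee : inner ℝ e e = (1 : ℝ) := by simp [he]
  have h1 : |inner ℝ e w| ≤ ‖w‖ := by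
    simpa [he] using abs_real_inner_le_norm e w
  have h2 : c • e + w - inner ℝ e (c • e + w) • e = w - inner ℝ e w • e := by
    rw [inner_add_right, inner_smul_right, hee]; module
  have h3 : ‖w - inner ℝ e w • e‖ ≤ 2 * ‖w‖ := by
    refine (norm_sub_le _ _).trans ?_
    rw [norm_smul, he, Real.norm_eq_abs]; linarith
  rw [h2, inner_add_right, inner_smul_right, hee]
  have := abs_le.1 h1
  have := mul_le_mul_of_nonneg_left h3 K.coe_nonneg
  nlinarith

lemma fderiv_nonneg_of_le_add {n : ℕ} {f : Space n → ℝ} {x v : Space n}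
    (hf : DifferentiableAt ℝ f x) (h : ∀ x, ∀ t : ℝ, 0 ≤ t → f x ≤ f (x + t • v)) :
    0 ≤ fderiv ℝ f x v := by
  have hm : Monotone (fun t : ℝ => f (x + t • v)) := by
    intro s t hst
    have := h (x + s • v) (t - s) (sub_nonneg.2 hst)
    rwa [add_assoc, ← add_smul, add_sub_cancel] at this
  have := hm.deriv_nonneg (x := 0)
  have h2 := hf.lineDeriv_eq_fderiv (v := v)
  rw [← h2]
  exact this

/-- Smooth cutoffs exhausting a Lipschitz supergraph, monotone along a cone. -/
lemma exists_cutoff {n : ℕ} {e : Space n} (he : ‖e‖ = 1) {γ : Space n → ℝ} {K : ℝ≥0}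
    (hγ : LipschitzWith K γ) :
    ∃ χ : ℕ → Space n → ℝ, (∀ k, ContDiff ℝ ∞ (χ k)) ∧ (∀ k x, 0 ≤ χ k x) ∧
      (∀ k x, χ k x ≤ 1) ∧ (∀ k, tsupport (χ k) ⊆ supergraph e γ) ∧
      (∀ k x w, |fderiv ℝ (χ k) x w| ≤ (1 + 2 * K) * ‖w‖ * fderiv ℝ (χ k) x e) ∧
      (∀ k x (t : ℝ), 0 ≤ t → χ k x ≤ χ k (x + t • e)) ∧
      ∀ x ∈ supergraph e γ, ∀ᶠ k in atTop, χ k x = 1 := by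
  set G := supergraph e γ with hG
  have hGo : IsOpen G := isOpen_supergraph hγ.continuous
  set ε : ℕ → ℝ := fun k => 1 / ((k : ℝ) + 1) with hε
  have hεpos : ∀ k, 0 < ε k := fun k => by positivity
  have hεlim : Tendsto ε atTop (𝓝 0) := tendsto_one_div_add_atTop_nhds_zero_nat
  -- The `2 ε k` covers one mollification radius and another `ε k` for the closure of the support;
  -- the factor `1 + 2K` lets the shift along `e` absorb any displacement of that size.
  set δ : ℕ → ℝ := fun k => (1 + 2 * K) * (2 * ε k) with hδ
  let ρ : ℕ → ContDiffBump (0 : Space n) := fun k =>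
    ⟨ε k / 2, ε k, half_pos (hεpos k), half_lt_self (hεpos k)⟩
  let g : ℕ → Space n → ℝ := fun k => ((fun y => y - δ k • e) ⁻¹' G).indicator 1
  have hgm : ∀ k, Measurable (g k) := fun k =>
    measurable_one.indicator ((hGo.preimage (by fun_prop)).measurableSet)
  have hg0 : ∀ k x, 0 ≤ g k x := fun k x => Set.indicator_nonneg (fun _ _ => zero_le_one) _
  have hg1 : ∀ k x, g k x ≤ 1 := fun k x => by
    simp only [g, Set.indicator]; split_ifs <;> simp
  have hgn : ∀ k x, ‖g k x‖ ≤ 1 := fun k x => by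
    rw [Real.norm_eq_abs, abs_of_nonneg (hg0 k x)]; exact hg1 k x
  have hgl : ∀ k, LocallyIntegrable (g k) := fun k =>
    LocallyIntegrable.mono (f := fun _ => (1 : ℝ)) (locallyIntegrable_const 1)
      (hgm k).aestronglyMeasurable (ae_of_all _ fun x => by simpa using hgn k x)
  let χ : ℕ → Space n → ℝ := fun k =>
    convolution ((ρ k).normed volume) (g k) (ContinuousLinearMap.lsmul ℝ ℝ) volume
  have hχ : ∀ k x, χ k x = ∫ t, (ρ k).normed volume t * g k (x - t) := fun k x => by
    simp [χ, convolution]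
  have hint : ∀ k x, Integrable (fun t => (ρ k).normed volume t * g k (x - t)) := fun k x =>
    (ρ k).integrable_normed.mul_bdd (c := 1)
      ((hgm k).comp (measurable_const.sub measurable_id)).aestronglyMeasurable
      (ae_of_all _ fun t => hgn k _)
  have hsm : ∀ k, ContDiff ℝ ∞ (χ k) := fun k =>
    (ρ k).hasCompactSupport_normed.contDiff_convolution_left _ (ρ k).contDiff_normed (hgl k)
  -- The indicator increases along every vector that maps `G` into itself, and averaging against a
  -- nonnegative kernel preserves this.
  have hmono : ∀ k (v : Space n), (∀ y ∈ G, y + v ∈ G) → ∀ x, χ k x ≤ χ k (x + v) := by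
    intro k v hv x
    rw [hχ, hχ]
    refine integral_mono (hint k x) (hint k (x + v)) fun t => ?_
    refine mul_le_mul_of_nonneg_left ?_ ((ρ k).nonneg_normed t)
    by_cases h : x - t - δ k • e ∈ G
    · have h' : x + v - t - δ k • e ∈ G := by
        have := hv _ h
        rwa [show x - t - δ k • e + v = x + v - t - δ k • e by abel] at this
      simp only [g, Set.indicator, Set.mem_preimage, h, h', if_true]; rfl
    · have : g k (x - t) = 0 := by simp [g, h]
      show g k (x - t) ≤ _
      rw [this]; exact hg0 k _
  have hdiff : ∀ k x, DifferentiableAt ℝ (χ k) x := fun k x =>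
    (hsm k).differentiable (by simp) x
  have hcone : ∀ k x w, 0 ≤ fderiv ℝ (χ k) x (((1 + 2 * K) * ‖w‖) • e + w) := by
    intro k x w
    refine fderiv_nonneg_of_le_add (hdiff k x) fun x t ht => hmono k _ (fun y hy => ?_) x
    have := smul_add_mem_supergraph he hγ hy (w := t • w) (c := (1 + 2 * K) * ‖t • w‖) le_rfl
    rw [norm_smul, Real.norm_eq_abs, abs_of_nonneg ht] at this
    convert this using 2
    rw [smul_add, smul_smul]; ring_nf
  refine ⟨χ, hsm, fun k x => ?_, fun k x => ?_, fun k => ?_, fun k x w => ?_, fun k x t ht => ?_,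
    fun x hx => ?_⟩
  · rw [hχ]
    exact integral_nonneg fun t => mul_nonneg ((ρ k).nonneg_normed t) (hg0 k _)
  · rw [hχ, ← (ρ k).integral_normed (μ := volume)]
    refine integral_mono (hint k x) (ρ k).integrable_normed fun t => ?_
    exact mul_le_of_le_one_right ((ρ k).nonneg_normed t) (hg1 k _)
  · intro x hx
    rw [tsupport, Metric.mem_closure_iff] at hx
    obtain ⟨y, hy, hxy⟩ := hx (ε k) (hεpos k)
    have : ∃ t, (ρ k).normed volume t * g k (y - t) ≠ 0 := by
      by_contra! hcon
      apply hy
      rw [hχ]; simp [hcon]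
    obtain ⟨t, ht⟩ := this
    have ht1 : t ∈ Metric.ball (0 : Space n) (ε k) := by
      have : t ∈ Function.support ((ρ k).normed volume) := left_ne_zero_of_mul ht
      rwa [(ρ k).support_normed_eq] at this
    have ht2 : y - t - δ k • e ∈ G := by
      by_contra hcon
      exact right_ne_zero_of_mul ht (by simp [g, hcon])
    have hw : ‖t + (x - y)‖ ≤ 2 * ε k := by
      refine (norm_add_le _ _).trans ?_
      rw [mem_ball_zero_iff] at ht1
      rw [dist_eq_norm] at hxy
      linarith
    have := smul_add_mem_supergraph he hγ ht2 (w := t + (x - y)) (c := δ k)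
      (mul_le_mul_of_nonneg_left hw (by positivity))
    rwa [show y - t - δ k • e + (δ k • e + (t + (x - y))) = x by abel] at this
  -- Nonnegativity along `(1 + 2K)‖w‖ e ± w` gives the two halves of the bound.
  · have h1 := hcone k x w
    have h2 := hcone k x (-w)
    rw [map_add, map_smul, smul_eq_mul] at h1
    rw [map_add, map_smul, smul_eq_mul, norm_neg, map_neg] at h2
    rw [abs_le]; constructor <;> linarith
  · refine hmono k _ (fun y hy => ?_) x
    have := smul_add_mem_supergraph he hγ hy (w := 0) (c := t) (by simpa using ht)
    simpa using this
  · obtain ⟨r, hr, hball⟩ := Metric.isOpen_iff.1 hGo x hx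
    have hlim : Tendsto (fun k => δ k + ε k) atTop (𝓝 0) := by
      have := ((hεlim.const_mul 2).const_mul (1 + 2 * (K : ℝ))).add hεlim
      simpa using this
    filter_upwards [hlim.eventually (gt_mem_nhds hr)] with k hk
    have h1 : ∀ y ∈ Metric.ball x (ρ k).rOut, g k y = 1 := by
      intro y hy
      have : y - δ k • e ∈ G := by
        apply hball
        rw [Metric.mem_ball, dist_eq_norm] at hy ⊢
        calc ‖y - δ k • e - x‖ = ‖(y - x) - δ k • e‖ := by congr 1; abel
          _ ≤ ‖y - x‖ + ‖δ k • e‖ := norm_sub_le _ _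
          _ = ‖y - x‖ + δ k := by
            rw [norm_smul, he, mul_one, Real.norm_eq_abs, abs_of_nonneg]; simp only [hδ]
            have := hεpos k; positivity
          _ < ε k + δ k := by gcongr
          _ < r := by linarith
      simp [g, this]
    have hxx := h1 x (Metric.mem_ball_self (hεpos k))
    have := (ρ k).normed_convolution_eq_right (μ := volume) (g := g k) (x₀ := x)
      (fun y hy => by rw [h1 y hy, hxx])
    rw [show χ k x = g k x from this, hxx]

/-! ### Divergence calculus and test fields -/

lemma sum_single_eq {n : ℕ} (L : Space n →L[ℝ] ℝ) (v : Space n) :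
    ∑ i, L (EuclideanSpace.single i 1) * v i = L v := by
  conv_rhs => rw [← (EuclideanSpace.basisFun (Fin n) ℝ).sum_repr v, map_sum]
  simp [mul_comm]

lemma divergence_smul {n : ℕ} {f : Space n → ℝ} {ψ : Space n → Space n} {x : Space n}
    (hf : DifferentiableAt ℝ f x) (hψ : DifferentiableAt ℝ ψ x) :
    divergence (fun y => f y • ψ y) x = f x * divergence ψ x + fderiv ℝ f x (ψ x) := by
  simp only [divergence]
  rw [fderiv_fun_smul hf hψ, ← sum_single_eq, Finset.mul_sum, ← Finset.sum_add_distrib]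
  refine Finset.sum_congr rfl fun i _ => ?_
  simp

lemma divergence_smul_const {n : ℕ} {f : Space n → ℝ} {x : Space n}
    (hf : DifferentiableAt ℝ f x) (e : Space n) :
    divergence (fun y => f y • e) x = fderiv ℝ f x e := by
  rw [divergence_smul hf (differentiableAt_const e)]
  simp [divergence]

lemma divergence_const_smul {n : ℕ} (c : ℝ) {ψ : Space n → Space n} {x : Space n}
    (hψ : DifferentiableAt ℝ ψ x) :
    divergence (fun y => c • ψ y) x = c * divergence ψ x := by
  rw [divergence_smul (differentiableAt_const c) hψ]
  simp

lemma divergence_sub {n : ℕ} {φ ψ : Space n → Space n} {x : Space n}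
    (hφ : DifferentiableAt ℝ φ x) (hψ : DifferentiableAt ℝ ψ x) :
    divergence (fun y => φ y - ψ y) x = divergence φ x - divergence ψ x := by
  simp only [divergence]
  rw [fderiv_fun_sub hφ hψ, ← Finset.sum_sub_distrib]
  rfl

lemma divergence_sum {n : ℕ} {ι : Type*} (s : Finset ι) {φ : ι → Space n → Space n} {x : Space n}
    (hφ : ∀ i ∈ s, DifferentiableAt ℝ (φ i) x) :
    divergence (fun y => ∑ i ∈ s, φ i y) x = ∑ i ∈ s, divergence (φ i) x := by
  simp only [divergence]
  rw [fderiv_fun_sum hφ, Finset.sum_comm]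
  refine Finset.sum_congr rfl fun i _ => ?_
  simp

lemma continuous_divergence {n : ℕ} {φ : Space n → Space n} (hφ : ContDiff ℝ ∞ φ) :
    Continuous (divergence φ) := by
  have := hφ.continuous_fderiv (by simp)
  unfold divergence
  fun_prop

lemma divergence_eq_zero {n : ℕ} {φ : Space n → Space n} {x : Space n} (hx : x ∉ tsupport φ) :
    divergence φ x = 0 := by
  have : fderiv ℝ φ x = 0 := by
    by_contra h
    exact hx (support_fderiv_subset ℝ h)
  simp [divergence, this]

lemma hasCompactSupport_divergence {n : ℕ} {φ : Space n → Space n} (hφ : HasCompactSupport φ) :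
    HasCompactSupport (divergence φ) :=
  HasCompactSupport.intro hφ fun _ hx => divergence_eq_zero hx

lemma integrable_mul_of_hasCompactSupport {n : ℕ} {μ : Measure (Space n)} {u h : Space n → ℝ}
    (hu : Integrable u μ) (hc : Continuous h) (hs : HasCompactSupport h) :
    Integrable (fun x => u x * h x) μ := by
  obtain ⟨C, hC⟩ := hs.exists_bound_of_continuous hc
  exact hu.mul_bdd hc.aestronglyMeasurable (ae_of_all _ hC)

lemma MemBV.integrable {n : ℕ} {Ω : Set (Space n)} {u : Space n → ℝ} (hu : MemBV Ω u) :
    Integrable u (volume.restrict Ω) :=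
  memLp_one_iff_integrable.1 hu.memLp

lemma integrable_mul_divergence {n : ℕ} {μ : Measure (Space n)} {U : Set (Space n)}
    {u : Space n → ℝ} {φ : Space n → Space n} (hu : Integrable u μ) (hφ : IsTestFunction U φ) :
    Integrable (fun x => u x * divergence φ x) μ :=
  integrable_mul_of_hasCompactSupport hu (continuous_divergence hφ.smooth)
    (hasCompactSupport_divergence hφ.compact)

lemma IsTestFunction.smul {n : ℕ} {F : Type*} [NormedAddCommGroup F] [NormedSpace ℝ F]
    {U V : Set (Space n)} {f : Space n → ℝ} {φ : Space n → F} (hf : ContDiff ℝ ∞ f)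
    (hφ : IsTestFunction V φ) (hU : tsupport f ∩ V ⊆ U) :
    IsTestFunction U (fun x => f x • φ x) where
  smooth := hf.smul hφ.smooth
  compact := hφ.compact.smul_left
  supp := fun _ hx => hU ⟨tsupport_smul_subset_left f φ hx,
    hφ.supp (tsupport_smul_subset_right f φ hx)⟩

lemma IsTestFunction.sub {n : ℕ} {F : Type*} [NormedAddCommGroup F] [NormedSpace ℝ F]
    {U : Set (Space n)} {φ ψ : Space n → F} (hφ : IsTestFunction U φ) (hψ : IsTestFunction U ψ) :
    IsTestFunction U (fun x => φ x - ψ x) where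
  smooth := hφ.smooth.sub hψ.smooth
  compact := HasCompactSupport.sub hφ.compact hψ.compact
  supp := (tsupport_sub φ ψ).trans (Set.union_subset hφ.supp hψ.supp)

/-- Dividing `φ` by `C` makes it a competitor in the supremum. -/
lemma integral_mul_divergence_le {n : ℕ} {U : Set (Space n)} {f : Space n → ℝ}
    (hf : totalVariation U f < ⊤) {φ : Space n → Space n} (hφ : IsTestFunction U φ) {C : ℝ}
    (hC : 0 < C) (hφC : ∀ x, ‖φ x‖ ≤ C) :
    ∫ x in U, f x * divergence φ x ≤ C * (totalVariation U f).toReal := by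
  have h1 : IsTestFunction U (fun x => C⁻¹ • φ x) :=
    IsTestFunction.smul (f := fun _ => C⁻¹) contDiff_const hφ Set.inter_subset_right
  have h2 : ∀ x, ‖C⁻¹ • φ x‖ ≤ 1 := fun x => by
    rw [norm_smul, norm_inv, Real.norm_of_nonneg hC.le, inv_mul_le_iff₀ hC]
    simpa using hφC x
  have h3 : ENNReal.ofReal (∫ x in U, f x * divergence (fun x => C⁻¹ • φ x) x)
      ≤ totalVariation U f :=
    le_iSup_of_le _ (le_iSup_of_le h1 (le_iSup_of_le h2 le_rfl))
  have h4 := ENNReal.toReal_mono hf.ne h3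
  have h5 : ∫ x in U, f x * divergence (fun x => C⁻¹ • φ x) x
      = C⁻¹ * ∫ x in U, f x * divergence φ x := by
    rw [← integral_const_mul]
    refine integral_congr_ae (ae_of_all _ fun x => ?_)
    simp only
    rw [divergence_const_smul _ (hφ.smooth.differentiable (by simp) x)]
    ring
  rw [h5, ENNReal.toReal_ofReal'] at h4
  have := (le_max_left _ _).trans h4
  rwa [inv_mul_le_iff₀ hC] at this

/-! ### Primitives along a direction -/

/-- The integral of `g` over the segment from `y - T • e` to `y`. -/
noncomputable def segmentIntegral {n : ℕ} (g : Space n → ℝ) (e : Space n) (T : ℝ) (y : Space n) : ℝ :=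
  ∫ t in (0 : ℝ)..T, g (y - t • e)

/-- This is a convolution of `g` with the constant 1 against the finite measure obtained by pushing
Lebesgue measure on `(0, T]` onto the segment, so it inherits the smoothness of `g`. -/
lemma contDiff_segmentIntegral {n : ℕ} {g : Space n → ℝ} (hg : ContDiff ℝ ∞ g)
    (hc : HasCompactSupport g) (e : Space n) {T : ℝ} (hT : 0 ≤ T) :
    ContDiff ℝ ∞ (segmentIntegral g e T) := by
  let μ : Measure (Space n) := (volume.restrict (Set.Ioc (0 : ℝ) T)).map (fun t => t • e)
  have : IsFiniteMeasure μ := by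
    have : IsFiniteMeasure (volume.restrict (Set.Ioc (0 : ℝ) T)) := ⟨by simp⟩
    exact Measure.isFiniteMeasure_map _ _
  have h := hc.contDiff_convolution_right (ContinuousLinearMap.lsmul ℝ ℝ) (μ := μ)
    (f := fun _ => (1 : ℝ)) (n := ⊤) (locallyIntegrable_const 1) hg
  convert h using 1
  ext y
  simp only [convolution, ContinuousLinearMap.lsmul_apply, one_smul, segmentIntegral]
  rw [intervalIntegral.integral_of_le hT, integral_map]
  · fun_prop
  · exact (hg.continuous.comp (by fun_prop)).aestronglyMeasurable

/-- On the line through `y` the function is the integral of `g` over a sliding window `[s - T, s]`;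
differentiate both endpoints. -/
lemma fderiv_segmentIntegral {n : ℕ} {g : Space n → ℝ} (hg : ContDiff ℝ ∞ g)
    (hc : HasCompactSupport g) (e : Space n) {T : ℝ} (hT : 0 ≤ T) (y : Space n) :
    fderiv ℝ (segmentIntegral g e T) y e = g y - g (y - T • e) := by
  have hd : DifferentiableAt ℝ (segmentIntegral g e T) y :=
    (contDiff_segmentIntegral hg hc e hT).differentiable (by simp) y
  rw [← hd.lineDeriv_eq_fderiv, lineDeriv]
  have hcont : Continuous (fun s : ℝ => g (y + s • e)) := hg.continuous.comp (by fun_prop)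
  have h1 : ∀ s : ℝ, segmentIntegral g e T (y + s • e)
      = (∫ τ in (0 : ℝ)..s, g (y + τ • e)) - ∫ τ in (0 : ℝ)..(s - T), g (y + τ • e) := by
    intro s
    rw [intervalIntegral.integral_interval_sub_left (hcont.intervalIntegrable _ _)
      (hcont.intervalIntegrable _ _)]
    have := intervalIntegral.integral_comp_sub_left (fun τ => g (y + τ • e)) s (a := 0) (b := T)
    rw [sub_zero] at this
    rw [← this]
    refine intervalIntegral.integral_congr fun t _ => ?_
    congr 1; module
  simp_rw [h1]
  have hF : ∀ b, HasDerivAt (fun u => ∫ τ in (0 : ℝ)..u, g (y + τ • e)) (g (y + b • e)) b :=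
    fun b => hcont.integral_hasStrictDerivAt 0 b |>.hasDerivAt
  have h2 := (hF 0).sub (HasDerivAt.comp_sub_const (0 : ℝ) T (hF (0 - T)))
  rw [show (fun t => (∫ τ in (0 : ℝ)..t, g (y + τ • e)) - ∫ τ in (0 : ℝ)..(t - T), g (y + τ • e))
    = (fun u => ∫ τ in (0 : ℝ)..u, g (y + τ • e)) -
      fun x => ∫ τ in (0 : ℝ)..(x - T), g (y + τ • e) from rfl, h2.deriv]
  simp [sub_eq_add_neg]

/-- The dominating integrand `C ∂ₑχ` integrates to `C` times an increment of `χ`, which is at most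
1. -/
lemma abs_segmentIntegral_le {n : ℕ} {g χ : Space n → ℝ} {e : Space n} {T C : ℝ} (hT : 0 ≤ T)
    (hg : Continuous g) (hχ : ContDiff ℝ ∞ χ) (h0 : ∀ x, 0 ≤ χ x) (h1 : ∀ x, χ x ≤ 1)
    (hC : 0 ≤ C) (hgχ : ∀ x, |g x| ≤ C * fderiv ℝ χ x e) (y : Space n) :
    |segmentIntegral g e T y| ≤ C := by
  have hderiv : ∀ t : ℝ, HasDerivAt (fun t : ℝ => -χ (y - t • e)) (fderiv ℝ χ (y - t • e) e) t := by
    intro t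
    have hd : HasFDerivAt χ (fderiv ℝ χ (y - t • e)) (y - t • e) :=
      (hχ.differentiable (by simp) _).hasFDerivAt
    have hl : HasDerivAt (fun t : ℝ => y - t • e) (-e) t := by
      simpa using ((hasDerivAt_id t).smul_const e).const_sub y
    have := (hd.comp_hasDerivAt t hl).neg
    rw [map_neg, neg_neg] at this
    exact this
  have hcont : Continuous (fun t : ℝ => fderiv ℝ χ (y - t • e) e) := by
    have := hχ.continuous_fderiv (by simp)
    exact (this.comp (by fun_prop)).clm_apply continuous_const
  have hcg : Continuous (fun t : ℝ => g (y - t • e)) := hg.comp (by fun_prop)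
  calc |segmentIntegral g e T y| ≤ ∫ t in (0 : ℝ)..T, |g (y - t • e)| :=
        intervalIntegral.abs_integral_le_integral_abs hT
    _ ≤ ∫ t in (0 : ℝ)..T, C * fderiv ℝ χ (y - t • e) e :=
        intervalIntegral.integral_mono_on hT (hcg.abs.intervalIntegrable _ _)
          ((hcont.const_mul C).intervalIntegrable _ _) fun t _ => hgχ _
    _ = C * (χ y - χ (y - T • e)) := by
        rw [intervalIntegral.integral_const_mul,
          intervalIntegral.integral_eq_sub_of_hasDerivAt (fun t _ => hderiv t)
            (hcont.intervalIntegrable _ _)]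
        simp only [zero_smul, sub_zero]; ring
    _ ≤ C * 1 := by
        gcongr
        linarith [h0 (y - T • e), h1 y]
    _ = C := mul_one C

/-- If `χ` vanishes near `y`, monotonicity and `χ ≥ 0` make it vanish near each `y - t • e`, so its
derivative, and with it `g`, is zero there. -/
lemma tsupport_segmentIntegral_subset {n : ℕ} {g χ : Space n → ℝ} {e : Space n} {T : ℝ}
    (hT : 0 ≤ T) (h0 : ∀ x, 0 ≤ χ x) (hmono : ∀ x (t : ℝ), 0 ≤ t → χ x ≤ χ (x + t • e))
    (hgχ : Function.support g ⊆ Function.support (fderiv ℝ χ)) :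
    tsupport (segmentIntegral g e T) ⊆ tsupport χ := by
  refine closure_minimal (fun y hy => ?_) (isClosed_tsupport χ)
  by_contra hcon
  apply hy
  have hz : ∀ t ∈ Set.uIcc (0 : ℝ) T, g (y - t • e) = 0 := by
    intro t ht
    rw [Set.uIcc_of_le hT] at ht
    by_contra hne
    have h1 : y - t • e ∈ tsupport χ := support_fderiv_subset ℝ (hgχ hne)
    have hev : ∀ᶠ z in 𝓝 (y - t • e), z + t • e ∉ tsupport χ := by
      have hc : ContinuousAt (fun z => z + t • e) (y - t • e) := by fun_prop
      refine hc.eventually_mem ((isClosed_tsupport χ).isOpen_compl.mem_nhds ?_)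
      simpa using hcon
    have hev2 : ∀ᶠ z in 𝓝 (y - t • e), χ z = 0 := by
      filter_upwards [hev] with z hz
      have := hmono z t ht.1
      rw [image_eq_zero_of_notMem_tsupport hz] at this
      exact le_antisymm this (h0 z)
    exact (notMem_tsupport_iff_eventuallyEq.2 hev2) h1
  simp only [segmentIntegral]
  rw [intervalIntegral.integral_congr (g := fun _ => 0) hz]
  simp

/-! ### Finite total variation of the extension by zero -/

/-- Near a boundary point where `Ω` is a Lipschitz supergraph, the distributional gradient of the
extension by zero is bounded. -/
lemma exists_bound_of_supergraph {n : ℕ} {Ω : Set (Space n)} (hΩ : IsOpen Ω)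
    {u : Space n → ℝ} (hu : MemBV Ω u) {x : Space n} {r : ℝ} (hr : 0 < r) {e : Space n}
    (he : ‖e‖ = 1) {K : ℝ≥0} {γ : Space n → ℝ} (hγ : LipschitzWith K γ)
    (hball : ∀ y ∈ Metric.ball x r, y ∈ Ω ↔ y ∈ supergraph e γ) :
    ∃ M : ℝ, ∀ ψ : Space n → Space n, IsTestFunction (Metric.ball x (r / 2)) ψ →
      (∀ y, ‖ψ y‖ ≤ 1) → ∫ y in Ω, u y * divergence ψ y ≤ M := by
  obtain ⟨χ, hχs, hχ0, hχ1, hχG, hχd, hχm, hχlim⟩ := exists_cutoff he hγ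
  -- Equal to 1 where `ψ` lives, and supported at radius `3r/4 < r`, where `Ω` is still the
  -- supergraph.
  let η : ContDiffBump x := ⟨r / 2, 3 / 4 * r, by positivity, by linarith⟩
  have hηs : ContDiff ℝ ∞ η := η.contDiff
  have hηc : HasCompactSupport (fun y => fderiv ℝ η y e) := η.hasCompactSupport.fderiv_apply ℝ e
  have hηd : Continuous (fun y => fderiv ℝ η y e) :=
    (hηs.continuous_fderiv (by simp)).clm_apply continuous_const
  obtain ⟨D, hD⟩ := hηc.exists_bound_of_continuous hηd
  have hD0 : 0 ≤ D := (norm_nonneg _).trans (hD x)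
  have hui := hu.integrable
  set C : ℝ := 1 + 2 * K with hC
  have hC0 : 0 ≤ C := by positivity
  refine ⟨(1 + C) * (totalVariation Ω u).toReal + C * D * ∫ y in Ω, |u y|, fun ψ hψ hψ1 => ?_⟩
  have hψd : ∀ y, DifferentiableAt ℝ ψ y := hψ.smooth.differentiable (by simp)
  have hηψ : ∀ y ∈ tsupport ψ, η y = 1 := fun y hy =>
    η.one_of_mem_closedBall (Metric.ball_subset_closedBall (hψ.supp hy))
  have hbound : ∀ k, ∫ y in Ω, u y * (χ k y * divergence ψ y)
      ≤ (1 + C) * (totalVariation Ω u).toReal + C * D * ∫ y in Ω, |u y| := by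
    intro k
    set g : Space n → ℝ := fun y => fderiv ℝ (χ k) y (ψ y) with hg
    have hgs : ContDiff ℝ ∞ g := by
      have h1 : ContDiff ℝ ∞ (fderiv ℝ (χ k)) := (hχs k).fderiv_right (by simp)
      exact h1.clm_apply hψ.smooth
    have hgψ : ∀ y, y ∉ tsupport ψ → g y = 0 := fun y hy => by
      simp [hg, image_eq_zero_of_notMem_tsupport hy]
    have hgc : HasCompactSupport g := HasCompactSupport.intro hψ.compact hgψ
    have hgC : ∀ y, |g y| ≤ C * fderiv ℝ (χ k) y e := by
      intro y
      have hpos : 0 ≤ fderiv ℝ (χ k) y e := by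
        have := (abs_nonneg _).trans (hχd k y e)
        rw [he, mul_one] at this
        exact nonneg_of_mul_nonneg_right this (by positivity)
      refine (hχd k y (ψ y)).trans ?_
      refine mul_le_mul_of_nonneg_right ?_ hpos
      exact mul_le_of_le_one_right hC0 (hψ1 y)
    -- The length `2r` is enough: from a point of `ball x r` the far endpoint lies outside `ball x
    -- (r / 2)`, so `g` vanishes there and `∂ₑW = g`.
    set W := segmentIntegral g e (2 * r) with hW
    have hT : 0 ≤ 2 * r := by positivity
    have hWs : ContDiff ℝ ∞ W := contDiff_segmentIntegral hgs hgc e hT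
    have hWd : ∀ y, DifferentiableAt ℝ W y := hWs.differentiable (by simp)
    have hWC : ∀ y, |W y| ≤ C :=
      abs_segmentIntegral_le hT hgs.continuous (hχs k) (hχ0 k) (hχ1 k) hC0 hgC
    have hWsupp : tsupport W ⊆ tsupport (χ k) := by
      refine tsupport_segmentIntegral_subset hT (hχ0 k) (hχm k) fun y hy hcon => hy ?_
      simp [hg, hcon]
    have hinΩ : ∀ s ≤ 3 / 4 * r, tsupport (χ k) ∩ Metric.closedBall x s ⊆ Ω := by
      rintro s hs y ⟨hy1, hy2⟩
      have : y ∈ Metric.ball x r := by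
        rw [Metric.mem_closedBall] at hy2; rw [Metric.mem_ball]; linarith
      exact (hball y this).2 (hχG k hy1)
    have hv1 : IsTestFunction Ω (fun y => χ k y • ψ y) := by
      refine IsTestFunction.smul (hχs k) hψ fun y hy => ?_
      exact hinΩ (r / 2) (by linarith) ⟨hy.1, Metric.ball_subset_closedBall hy.2⟩
    have hηe : IsTestFunction (Metric.closedBall x (3 / 4 * r)) (fun y => η y • e) :=
      ⟨hηs.smul contDiff_const, η.hasCompactSupport.smul_right,
        (tsupport_smul_subset_left _ _).trans η.tsupport_eq.subset⟩
    have hv2 : IsTestFunction Ω (fun y => W y • η y • e) := by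
      refine IsTestFunction.smul hWs hηe fun y hy => ?_
      exact hinΩ _ le_rfl ⟨hWsupp hy.1, hy.2⟩
    have hηn : ∀ y, ‖η y‖ ≤ 1 := fun y => by
      rw [Real.norm_of_nonneg η.nonneg]; exact η.le_one
    have hvn : ∀ y, ‖χ k y • ψ y - W y • η y • e‖ ≤ 1 + C := by
      intro y
      refine (norm_sub_le _ _).trans (add_le_add ?_ ?_)
      · rw [norm_smul, Real.norm_of_nonneg (hχ0 k y)]
        exact mul_le_one₀ (hχ1 k y) (norm_nonneg _) (hψ1 y)
      · rw [norm_smul, norm_smul, he, mul_one, Real.norm_eq_abs]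
        calc |W y| * ‖η y‖ ≤ C * 1 := mul_le_mul (hWC y) (hηn y) (norm_nonneg _) hC0
          _ = C := mul_one C
    -- The term `∇χ · ψ = η ∂ₑW` is absorbed into the divergence of `W η e`, leaving only `W ∂ₑη`,
    -- which is bounded independently of `k`.
    have hkey : ∀ y, χ k y * divergence ψ y
        = divergence (fun y => χ k y • ψ y - W y • η y • e) y + W y * fderiv ℝ η y e := by
      intro y
      have hd1 : DifferentiableAt ℝ (χ k) y := (hχs k).differentiable (by simp) y
      have hd2 : DifferentiableAt ℝ η y := hηs.differentiable (by simp) y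
      rw [divergence_sub (hd1.fun_smul (hψd y)) ((hWd y).fun_smul (hd2.fun_smul (differentiableAt_const e))),
        divergence_smul hd1 (hψd y), divergence_smul (hWd y) (hd2.fun_smul (differentiableAt_const e)),
        divergence_smul_const hd2, map_smul, smul_eq_mul,
        fderiv_segmentIntegral hgs hgc e hT]
      have : g y = η y * (g y - g (y - (2 * r) • e)) := by
        by_cases hy : y ∈ Metric.ball x r
        · have h2 : g (y - (2 * r) • e) = 0 := by
            refine hgψ _ fun hcon => ?_
            have h3 := hψ.supp hcon
            rw [Metric.mem_ball, dist_eq_norm] at h3 hy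
            have h4 : ‖(2 * r) • e‖ ≤ ‖y - x‖ + ‖y - (2 * r) • e - x‖ := by
              rw [show (2 * r) • e = (y - x) - (y - (2 * r) • e - x) by abel]
              convert norm_sub_le (y - x) (y - (2 * r) • e - x) using 2
              abel_nf
            rw [norm_smul, he, mul_one, Real.norm_of_nonneg hT] at h4
            linarith
          rw [h2, sub_zero]
          by_cases hy2 : y ∈ tsupport ψ
          · rw [hηψ y hy2, one_mul]
          · rw [hgψ y hy2, mul_zero]
        · have h1 : g y = 0 := hgψ y fun hcon => hy
            (Metric.ball_subset_ball (by linarith) (hψ.supp hcon))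
          have h2 : η y = 0 := by
            refine η.zero_of_le_dist ?_
            rw [Metric.mem_ball, not_lt] at hy
            show 3 / 4 * r ≤ _
            linarith
          rw [h1, h2, zero_mul]
      rw [← this]; simp only [hg]; ring
    have hWη : Continuous (fun y => W y * fderiv ℝ η y e) := hWs.continuous.mul hηd
    have hi2 : Integrable (fun y => u y * (W y * fderiv ℝ η y e)) (volume.restrict Ω) :=
      integrable_mul_of_hasCompactSupport hui hWη hηc.mul_left
    simp_rw [hkey, mul_add]
    rw [integral_add (integrable_mul_divergence hui (hv1.sub hv2)) hi2]
    refine add_le_add (integral_mul_divergence_le hu.variation_lt_top (hv1.sub hv2)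
      (by positivity) hvn) ?_
    rw [← integral_const_mul]
    refine integral_mono hi2 (hui.abs.const_mul _) fun y => ?_
    refine (le_abs_self _).trans ?_
    rw [abs_mul, mul_comm]
    refine mul_le_mul_of_nonneg_right ?_ (abs_nonneg _)
    rw [abs_mul]
    exact mul_le_mul (hWC y) (hD y) (abs_nonneg _) hC0
  have hdiv := hasCompactSupport_divergence hψ.compact
  have hdc := continuous_divergence hψ.smooth
  have hmain := integrable_mul_divergence hui hψ
  refine le_of_tendsto' (f := fun k => ∫ y in Ω, u y * (χ k y * divergence ψ y)) (x := atTop)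
    ?_ hbound
  -- The cutoffs tend to 1 on the part of `Ω` inside the ball, and outside the ball `divergence ψ`
  -- vanishes.
  refine tendsto_integral_of_dominated_convergence (fun y => ‖u y * divergence ψ y‖) ?_
    hmain.norm ?_ ?_
  · intro k
    exact hui.aestronglyMeasurable.mul
      ((hχs k).continuous.mul hdc).aestronglyMeasurable
  · intro k
    refine ae_of_all _ fun y => ?_
    rw [mul_left_comm, norm_mul (χ k y), Real.norm_of_nonneg (hχ0 k y)]
    exact mul_le_of_le_one_left (norm_nonneg _) (hχ1 k y)
  · refine (ae_restrict_mem hΩ.measurableSet).mono fun y hy => ?_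
    by_cases hyb : y ∈ Metric.ball x r
    · refine tendsto_const_nhds.congr' ?_
      filter_upwards [hχlim y ((hball y hyb).1 hy)] with k hk
      rw [hk, one_mul]
    · have : divergence ψ y = 0 := divergence_eq_zero fun hcon => hyb
        (Metric.ball_subset_ball (by linarith) (hψ.supp hcon))
      simp [this]

/-- Interior points use the variation in `Ω` itself, boundary points the graph argument, and near
exterior points the integral is zero. -/
lemma exists_local_bound {n : ℕ} {Ω : Set (Space n)} (hΩ : IsOpen Ω)
    (hLip : HasLipschitzBoundary Ω) {u : Space n → ℝ} (hu : MemBV Ω u) (x : Space n) :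
    ∃ s > 0, ∃ M : ℝ, ∀ ψ : Space n → Space n, IsTestFunction (Metric.ball x s) ψ →
      (∀ y, ‖ψ y‖ ≤ 1) → ∫ y in Ω, u y * divergence ψ y ≤ M := by
  by_cases hx : x ∈ Ω
  · obtain ⟨s, hs, hball⟩ := Metric.isOpen_iff.1 hΩ x hx
    refine ⟨s, hs, 1 * (totalVariation Ω u).toReal, fun ψ hψ h1 => ?_⟩
    exact integral_mul_divergence_le hu.variation_lt_top
      ⟨hψ.smooth, hψ.compact, hψ.supp.trans hball⟩ one_pos h1
  by_cases hx2 : x ∈ closure Ω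
  · obtain ⟨r, e, K, γ, hr, he, hγ, hball⟩ := hLip x ⟨hx2, by rwa [hΩ.interior_eq]⟩
    obtain ⟨M, hM⟩ := exists_bound_of_supergraph hΩ hu hr he hγ hball
    exact ⟨r / 2, by positivity, M, hM⟩
  · obtain ⟨s, hs, hball⟩ := Metric.isOpen_iff.1 isClosed_closure.isOpen_compl x hx2
    refine ⟨s, hs, 0, fun ψ hψ _ => le_of_eq ?_⟩
    rw [← integral_zero (Space n) ℝ (μ := volume.restrict Ω)]
    refine setIntegral_congr_fun hΩ.measurableSet fun y hy => ?_
    have : y ∉ tsupport ψ := fun hcon => hball (hψ.supp hcon) (subset_closure hy)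
    simp [divergence_eq_zero this]

lemma divergence_congr {n : ℕ} {φ ψ : Space n → Space n} {x : Space n} (h : φ =ᶠ[𝓝 x] ψ) :
    divergence φ x = divergence ψ x := by
  simp only [divergence, h.fderiv_eq]

open scoped Manifold in
/-- The extension by zero of a `BV` function on a bounded Lipschitz domain has finite total
variation. -/
theorem energyTV_lt_top {n : ℕ} {Ω : Set (Space n)} (hΩ : IsOpen Ω)
    (hbdd : Bornology.IsBounded Ω) (hLip : HasLipschitzBoundary Ω) {u : Space n → ℝ}
    (hu : MemBV Ω u) : energyTV Ω u < ⊤ := by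
  choose s hs M hM using exists_local_bound hΩ hLip hu
  obtain ⟨t, -, ht⟩ := hbdd.isCompact_closure.elim_nhds_subcover
    (fun x => Metric.ball x (s x)) fun x _ => Metric.ball_mem_nhds x (hs x)
  have ht2 : closure Ω ⊆ ⋃ i : t, Metric.ball (i : Space n) (s i) := fun y hy => by
    obtain ⟨x, hx, hxy⟩ := Set.mem_iUnion₂.1 (ht hy)
    exact Set.mem_iUnion.2 ⟨⟨x, hx⟩, hxy⟩
  obtain ⟨f, hf⟩ := SmoothPartitionOfUnity.exists_isSubordinate 𝓘(ℝ, Space n)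
    isClosed_closure (fun i : t => Metric.ball (i : Space n) (s i)) (fun _ => Metric.isOpen_ball) ht2
  have hfs : ∀ i, ContDiff ℝ ∞ (f i) := fun i => (f i).contMDiff.contDiff
  refine lt_of_le_of_lt (b := ENNReal.ofReal (∑ i : t, M i)) ?_ ENNReal.ofReal_lt_top
  refine iSup_le fun φ => iSup_le fun hφ => iSup_le fun hφ1 => ENNReal.ofReal_le_ofReal ?_
  have htest : ∀ i : t, IsTestFunction (Metric.ball (i : Space n) (s i)) (fun y => f i y • φ y) :=
    fun i => IsTestFunction.smul (hfs i) hφ fun y hy => hf i hy.1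
  -- The partition sums to 1 only on `closure Ω`; openness of `Ω` gives the identity near `y`, which
  -- is what differentiation needs.
  have hdiv : ∀ y ∈ Ω, divergence φ y = ∑ i : t, divergence (fun y => f i y • φ y) y := by
    intro y hy
    rw [← divergence_sum _ fun i _ => (htest i).smooth.differentiable (by simp) y]
    refine divergence_congr ?_
    filter_upwards [hΩ.mem_nhds hy] with z hz
    have := f.sum_eq_one (subset_closure hz)
    rw [finsum_eq_sum_of_fintype] at this
    rw [← Finset.sum_smul, this, one_smul]
  have hind : ∀ y, Ω.indicator u y * divergence φ y
      = Ω.indicator (fun y => u y * divergence φ y) y := fun y => by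
    simp only [Set.indicator]; split_ifs <;> simp
  simp_rw [Measure.restrict_univ, hind]
  rw [integral_indicator hΩ.measurableSet]
  calc ∫ y in Ω, u y * divergence φ y
      = ∫ y in Ω, ∑ i : t, u y * divergence (fun y => f i y • φ y) y :=
        setIntegral_congr_fun hΩ.measurableSet fun y hy => by
          simp only [hdiv y hy, Finset.mul_sum]
    _ = ∑ i : t, ∫ y in Ω, u y * divergence (fun y => f i y • φ y) y :=
        integral_finsetSum _ fun i _ => integrable_mul_divergence hu.integrable (htest i)
    _ ≤ ∑ i : t, M i := Finset.sum_le_sum fun i _ => hM i _ (htest i) fun y => by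
        rw [norm_smul, Real.norm_of_nonneg (f.nonneg i y)]
        exact mul_le_one₀ (f.le_one i y) (norm_nonneg _) (hφ1 y)

/-! ### Gradients, integration by parts and mollification -/

lemma inner_gradient {n : ℕ} (v : Space n → ℝ) (x w : Space n) :
    inner ℝ (gradient v x) w = fderiv ℝ v x w := by
  simp [gradient]

lemma gradient_apply {n : ℕ} (v : Space n → ℝ) (x : Space n) (i : Fin n) :
    gradient v x i = fderiv ℝ v x (EuclideanSpace.single i 1) := by
  rw [← inner_gradient, EuclideanSpace.inner_single_right]
  simp

lemma norm_gradient {n : ℕ} (v : Space n → ℝ) (x : Space n) :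
    ‖gradient v x‖ = ‖fderiv ℝ v x‖ := by
  simp [gradient]

lemma contDiff_gradient {n : ℕ} {v : Space n → ℝ} (hv : ContDiff ℝ ∞ v) :
    ContDiff ℝ ∞ (gradient v) :=
  (InnerProductSpace.toDual ℝ (Space n)).symm.contDiff.comp (hv.fderiv_right (by simp))

lemma gradient_eq_zero {n : ℕ} {v : Space n → ℝ} {x : Space n} (hx : x ∉ tsupport v) :
    gradient v x = 0 := by
  have : fderiv ℝ v x = 0 := by
    by_contra h
    exact hx (support_fderiv_subset ℝ h)
  simp [gradient, this]

lemma hasCompactSupport_gradient {n : ℕ} {v : Space n → ℝ} (hv : HasCompactSupport v) :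
    HasCompactSupport (gradient v) :=
  HasCompactSupport.intro hv fun _ hx => gradient_eq_zero hx

lemma integral_mul_fderiv_eq_neg {n : ℕ} {v φ : Space n → ℝ} (hv : ContDiff ℝ ∞ v)
    (hφ : ContDiff ℝ ∞ φ) (hc : HasCompactSupport φ) (w : Space n) :
    ∫ x, v x * fderiv ℝ φ x w = - ∫ x, fderiv ℝ v x w * φ x := by
  have h1 : Continuous (fun x => fderiv ℝ v x w) :=
    (hv.continuous_fderiv (by simp)).clm_apply continuous_const
  have h2 : Continuous (fun x => fderiv ℝ φ x w) :=
    (hφ.continuous_fderiv (by simp)).clm_apply continuous_const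
  refine integral_mul_fderiv_eq_neg_fderiv_mul_of_integrable ?_ ?_ ?_
    (fun x _ => hv.differentiable (by simp) x) (fun x _ => hφ.differentiable (by simp) x)
  · exact (h1.mul hφ.continuous).integrable_of_hasCompactSupport hc.mul_left
  · exact (hv.continuous.mul h2).integrable_of_hasCompactSupport (hc.fderiv_apply ℝ w).mul_left
  · exact (hv.continuous.mul hφ.continuous).integrable_of_hasCompactSupport hc.mul_left

lemma integral_mul_divergence_eq_neg {n : ℕ} {v : Space n → ℝ} {φ : Space n → Space n}
    (hv : ContDiff ℝ ∞ v) (hφ : IsTestFunction Set.univ φ) :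
    ∫ x, v x * divergence φ x = - ∫ x, fderiv ℝ v x (φ x) := by
  have hcoord : ∀ i : Fin n, ContDiff ℝ ∞ (fun x => φ x i) := fun i =>
    (EuclideanSpace.proj (𝕜 := ℝ) i).contDiff.comp hφ.smooth
  have hcc : ∀ i : Fin n, HasCompactSupport (fun x => φ x i) := fun i =>
    hφ.compact.comp_left (g := fun y : Space n => y i) rfl
  have hfd : ∀ x w, ∀ i : Fin n, fderiv ℝ φ x w i = fderiv ℝ (fun x => φ x i) x w := by
    intro x w i
    have h1 : HasFDerivAt φ (fderiv ℝ φ x) x :=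
      (hφ.smooth.differentiable (by simp) x).hasFDerivAt
    have h2 := (EuclideanSpace.proj (𝕜 := ℝ) i).hasFDerivAt.comp x h1
    exact (congrArg (fun L => L w) h2.fderiv).symm
  have hdc : ∀ w, Continuous (fun x => fderiv ℝ v x w) := fun w =>
    (hv.continuous_fderiv (by simp)).clm_apply continuous_const
  simp_rw [← sum_single_eq (fderiv ℝ v _) (φ _), divergence, Finset.mul_sum, hfd]
  rw [integral_finsetSum, integral_finsetSum, ← Finset.sum_neg_distrib]
  · exact Finset.sum_congr rfl fun i _ => integral_mul_fderiv_eq_neg hv (hcoord i) (hcc i) _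
  · intro i _
    exact ((hdc _).mul (hcoord i).continuous).integrable_of_hasCompactSupport (hcc i).mul_left
  · intro i _
    exact (hv.continuous.mul (((hcoord i).continuous_fderiv (by simp)).clm_apply
      continuous_const)).integrable_of_hasCompactSupport ((hcc i).fderiv_apply ℝ _).mul_left

/-- The `L¹` norm of the gradient of a test function is bounded by its total variation. -/
lemma integral_norm_gradient_le {n : ℕ} {v : Space n → ℝ} (hv : IsTestFunction Set.univ v) {E : ℝ}
    (hE : ∀ φ : Space n → Space n, IsTestFunction Set.univ φ → (∀ x, ‖φ x‖ ≤ 1) →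
      ∫ x, v x * divergence φ x ≤ E) :
    ∫ x, ‖gradient v x‖ ≤ E := by
  have hgs := contDiff_gradient hv.smooth
  have hgc := hasCompactSupport_gradient hv.compact
  have hgi : Integrable (fun x => ‖gradient v x‖) :=
    hgs.continuous.norm.integrable_of_hasCompactSupport hgc.norm
  set S := tsupport v with hS
  have hSv : volume S < ⊤ := hv.compact.measure_lt_top
  have hSm : MeasurableSet S := (isClosed_tsupport v).measurableSet
  have hε : ∀ ε > 0, ∫ x, ‖gradient v x‖ ≤ E + ε * volume.real S := by
    intro ε hε
    -- The optimal field `-∇v / |∇v|` need not be smooth where the gradient vanishes, so its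
    -- denominator is regularised.
    set q : Space n → ℝ := fun x => √(‖gradient v x‖ ^ 2 + ε ^ 2) with hq
    have hqpos : ∀ x, 0 < q x := fun x => Real.sqrt_pos.2 (by positivity)
    have hqs : ContDiff ℝ ∞ q :=
      ((hgs.norm_sq ℝ).add contDiff_const).sqrt fun x => by positivity
    have hqi : ContDiff ℝ ∞ (fun x => -(q x)⁻¹) := (hqs.inv fun x => (hqpos x).ne').neg
    have hgq : ∀ x, ‖gradient v x‖ ≤ q x := fun x => Real.le_sqrt_of_sq_le (by nlinarith)
    have hqg : ∀ x, q x ≤ ‖gradient v x‖ + ε := fun x =>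
      Real.sqrt_le_iff.2 ⟨by positivity, by nlinarith [norm_nonneg (gradient v x)]⟩
    have hφ : IsTestFunction Set.univ (fun x => -(q x)⁻¹ • gradient v x) :=
      ⟨hqi.smul hgs, HasCompactSupport.smul_left (f := fun x => -(q x)⁻¹) hgc, Set.subset_univ _⟩
    have h1 := hE _ hφ fun x => by
      rw [norm_smul, norm_neg, norm_inv, Real.norm_of_nonneg (hqpos x).le,
        inv_mul_le_iff₀ (hqpos x), mul_one]
      exact hgq x
    rw [integral_mul_divergence_eq_neg hv.smooth hφ, ← integral_neg] at h1
    have h2 : ∀ x, -fderiv ℝ v x (-(q x)⁻¹ • gradient v x) = (q x)⁻¹ * ‖gradient v x‖ ^ 2 := by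
      intro x
      rw [map_smul, ← inner_gradient, real_inner_self_eq_norm_sq, smul_eq_mul]; ring
    simp_rw [h2] at h1
    have h3 : Integrable (fun x => (q x)⁻¹ * ‖gradient v x‖ ^ 2) := by
      refine Continuous.integrable_of_hasCompactSupport ?_ ?_
      · exact (hqs.continuous.inv₀ fun x => (hqpos x).ne').mul (hgs.continuous.norm.pow 2)
      · refine HasCompactSupport.intro hgc fun x hx => ?_
        simp [image_eq_zero_of_notMem_tsupport hx]
    have h4 : Integrable (S.indicator fun _ => ε) :=
      (integrable_indicator_iff hSm).2 (integrableOn_const hSv.ne)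
    calc ∫ x, ‖gradient v x‖ ≤ ∫ x, ((q x)⁻¹ * ‖gradient v x‖ ^ 2 + S.indicator (fun _ => ε) x) := by
          refine integral_mono hgi (h3.add h4) fun x => ?_
          by_cases hx : x ∈ S
          · simp only [Set.indicator_of_mem hx]
            -- With `a = |∇v|` and `a > ε`, `(a - ε) q ≤ (a - ε)(a + ε) ≤ a²`; for `a ≤ ε` the left
            -- side is nonpositive.
            have : ‖gradient v x‖ - ε ≤ (q x)⁻¹ * ‖gradient v x‖ ^ 2 := by
              rw [le_inv_mul_iff₀ (hqpos x)]
              have h5 := hqg x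
              have h6 := hqpos x
              have h7 := hgq x
              by_cases h8 : ‖gradient v x‖ ≤ ε
              · nlinarith [sq_nonneg ‖gradient v x‖]
              · nlinarith [sq_nonneg ε]
            linarith
          · simp [gradient_eq_zero hx, Set.indicator_of_notMem hx]
      _ = (∫ x, (q x)⁻¹ * ‖gradient v x‖ ^ 2) + ε * volume.real S := by
          rw [integral_add h3 h4, integral_indicator hSm, setIntegral_const, smul_eq_mul, mul_comm ε]
      _ ≤ E + ε * volume.real S := by gcongr
  refine ge_of_tendsto (f := fun ε : ℝ => E + ε * volume.real S) (x := 𝓝[>] (0 : ℝ)) ?_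
    (Filter.eventually_of_mem self_mem_nhdsWithin hε)
  have : Tendsto (fun ε : ℝ => E + ε * volume.real S) (𝓝 0) (𝓝 (E + 0 * volume.real S)) :=
    (by fun_prop : Continuous fun ε : ℝ => E + ε * volume.real S).tendsto 0
  rw [zero_mul, add_zero] at this
  exact this.mono_left nhdsWithin_le_nhds

/-- Mollification does not increase the total variation. -/
lemma integral_convolution_mul_divergence_le {n : ℕ} {f : Space n → ℝ} (hf : Integrable f)
    (hTV : totalVariation Set.univ f < ⊤) (ρ : ContDiffBump (0 : Space n))
    {φ : Space n → Space n} (hφ : IsTestFunction Set.univ φ) (hφ1 : ∀ x, ‖φ x‖ ≤ 1) :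
    ∫ x, (convolution (ρ.normed volume) f (ContinuousLinearMap.lsmul ℝ ℝ) volume) x * divergence φ x
      ≤ (totalVariation Set.univ f).toReal := by
  have hdc := continuous_divergence hφ.smooth
  have hds := hasCompactSupport_divergence hφ.compact
  obtain ⟨C, hC⟩ := hds.exists_bound_of_continuous hdc
  have hprod : Integrable (fun p : Space n × Space n =>
      (ρ.normed volume p.2 * f (p.1 - p.2)) * divergence φ p.1) (volume.prod volume) := by
    have h := ρ.integrable_normed (μ := (volume : Measure (Space n))).convolution_integrand
      (ContinuousLinearMap.lsmul ℝ ℝ) hf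
    exact h.mul_bdd (c := C) (hdc.comp continuous_fst).aestronglyMeasurable
      (ae_of_all _ fun p => hC p.1)
  -- Translating `f` amounts to translating the test field the other way, which keeps it admissible.
  have hshift : ∀ t, ∫ x, f (x - t) * divergence φ x ≤ (totalVariation Set.univ f).toReal := by
    intro t
    have ht : IsTestFunction Set.univ (fun x => φ (x + t)) :=
      ⟨hφ.smooth.comp (contDiff_id.add contDiff_const),
        hφ.compact.comp_homeomorph (Homeomorph.addRight t), Set.subset_univ _⟩
    have h1 := integral_mul_divergence_le hTV ht one_pos fun x => hφ1 _
    rw [one_mul, Measure.restrict_univ] at h1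
    refine le_trans (le_of_eq ?_) h1
    rw [← integral_add_right_eq_self _ t]
    refine integral_congr_ae (ae_of_all _ fun x => ?_)
    simp only [add_sub_cancel_right, divergence, fderiv_comp_add_right]
  have heq : ∀ x, (convolution (ρ.normed volume) f (ContinuousLinearMap.lsmul ℝ ℝ) volume) x
      * divergence φ x = ∫ t, (ρ.normed volume t * f (x - t)) * divergence φ x := fun x => by
    rw [integral_mul_const]; rfl
  simp_rw [heq]
  rw [integral_integral_swap hprod]
  have h2 : ∀ t, ∫ x, ρ.normed volume t * f (x - t) * divergence φ x
      = ρ.normed volume t * ∫ x, f (x - t) * divergence φ x := fun t => by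
    rw [← integral_const_mul]; simp_rw [mul_assoc]
  calc ∫ t, ∫ x, ρ.normed volume t * f (x - t) * divergence φ x
      ≤ ∫ t, ρ.normed volume t * (totalVariation Set.univ f).toReal := by
        refine integral_mono hprod.integral_prod_right (ρ.integrable_normed.mul_const _) fun t => ?_
        simp only [h2]
        exact mul_le_mul_of_nonneg_left (hshift t) (ρ.nonneg_normed t)
    _ = (totalVariation Set.univ f).toReal := by
        rw [integral_mul_const, ρ.integral_normed, one_mul]

/-! ### The Sobolev inequality and the embedding constant -/

lemma critExponent_one : critExponent 1 = ⊤ := by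
  simp [critExponent]

lemma critExponent_eq_coe {n : ℕ} (hn : 2 ≤ n) :
    critExponent n = (((n : ℝ≥0) / ((n : ℝ≥0) - 1) : ℝ≥0) : ℝ≥0∞) := by
  have h1 : (1 : ℝ≥0) < n := by exact_mod_cast hn
  rw [critExponent, ENNReal.coe_div (tsub_pos_of_lt h1).ne', ENNReal.coe_sub]
  simp

lemma toReal_one_div_critExponent {n : ℕ} (hn : 1 ≤ n) :
    (1 / critExponent n).toReal = ((n : ℝ) - 1) / n := by
  rcases hn.eq_or_lt with rfl | hn2
  · simp [critExponent_one]
  · have h1 : (1 : ℝ≥0) ≤ n := by exact_mod_cast hn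
    rw [critExponent_eq_coe hn2, one_div, ENNReal.toReal_inv, ENNReal.coe_toReal,
      NNReal.coe_div, NNReal.coe_sub h1, inv_div]
    simp

/-- The fundamental theorem of calculus, after identifying `Space 1` isometrically with `ℝ`; it
supplies the endpoint case `n = 1`. -/
lemma enorm_le_lintegral_gradient {φ : Space 1 → ℝ} (hφ : IsTestFunction Set.univ φ) (x : Space 1) :
    ‖φ x‖ₑ ≤ ∫⁻ y, ‖gradient φ y‖ₑ := by
  let L : ℝ ≃ₗᵢ[ℝ] Space 1 := (OrthonormalBasis.singleton (Fin 1) ℝ).repr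
  have hL : ContDiff ℝ 1 L := L.contDiff
  have h1 : ContDiff ℝ 1 (φ ∘ L) := (hφ.smooth.of_le (by simp)).comp hL
  have h2 : HasCompactSupport (φ ∘ L) := hφ.compact.comp_homeomorph L.toHomeomorph
  have h3 := HasCompactSupport.enorm_le_lintegral_Ici_deriv h1 h2 (L.symm x)
  simp only [Function.comp_apply, LinearIsometryEquiv.apply_symm_apply] at h3
  refine h3.trans ((setLIntegral_le_lintegral _ _).trans ?_)
  rw [← L.measurePreserving.lintegral_comp_emb L.toHomeomorph.measurableEmbedding]
  refine lintegral_mono fun t => ?_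
  have h4 : HasDerivAt (φ ∘ L) (fderiv ℝ φ (L t) (L 1)) t :=
    (hφ.smooth.differentiable (by simp) (L t)).hasFDerivAt.comp_hasDerivAt t
      (L.toContinuousLinearEquiv.hasFDerivAt (x := t)).hasDerivAt
  rw [h4.deriv, enorm_le_iff_norm_le, norm_gradient]
  refine (ContinuousLinearMap.le_opNorm _ _).trans ?_
  rw [L.norm_map]; simp

/-- The Gagliardo–Nirenberg–Sobolev inequality for test functions, in any dimension. -/
lemma exists_eLpNorm_le_gradient {n : ℕ} (hn : 1 ≤ n) :
    ∃ C : ℝ≥0, ∀ φ : Space n → ℝ, IsTestFunction Set.univ φ →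
      eLpNorm φ (critExponent n) volume ≤ C * eLpNorm (gradient φ) 1 volume := by
  rcases hn.eq_or_lt with rfl | hn2
  · refine ⟨1, fun φ hφ => ?_⟩
    rw [critExponent_one, eLpNorm_exponent_top, ENNReal.coe_one, one_mul,
      eLpNorm_one_eq_lintegral_enorm]
    exact eLpNormEssSup_le_of_ae_enorm_bound (ae_of_all _ (enorm_le_lintegral_gradient hφ))
  · rw [critExponent_eq_coe hn2]
    have h1 : (1 : ℝ≥0) < n := by exact_mod_cast hn2
    have hp : NNReal.HolderConjugate (Module.finrank ℝ (Space n) : ℝ≥0)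
        ((n : ℝ≥0) / ((n : ℝ≥0) - 1)) := by
      rw [finrank_euclideanSpace_fin]
      exact NNReal.HolderConjugate.conjExponent h1
    refine ⟨eLpNormLESNormFDerivOneConst (volume : Measure (Space n))
      (((n : ℝ≥0) / ((n : ℝ≥0) - 1) : ℝ≥0) : ℝ), fun φ hφ => ?_⟩
    refine (eLpNorm_le_eLpNorm_fderiv_one volume (hφ.smooth.of_le (by simp)) hφ.compact hp).trans ?_
    refine le_of_eq ?_
    congr 1
    exact eLpNorm_congr_norm_ae (ae_of_all _ fun x => (norm_gradient φ x).symm)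

/-- Fatou's lemma for `L^p` norms, in the form used for both limits below. -/
lemma eLpNorm_le_of_tendsto {α : Type*} {m : MeasurableSpace α} {μ : Measure α} {p : ℝ≥0∞}
    {f : ℕ → α → ℝ} {f_lim : α → ℝ} {C : ℝ≥0} {a : ℕ → ℝ≥0∞} {b : ℝ≥0∞}
    (hf : ∀ k, AEStronglyMeasurable (f k) μ)
    (hlim : ∀ᵐ x ∂μ, Tendsto (fun k => f k x) atTop (𝓝 (f_lim x)))
    (hle : ∀ k, eLpNorm (f k) p μ ≤ C * a k) (ha : Tendsto a atTop (𝓝 b)) :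
    eLpNorm f_lim p μ ≤ C * b :=
  (Lp.eLpNorm_lim_le_liminf_eLpNorm hf f_lim hlim).trans <|
    (liminf_le_liminf (Eventually.of_forall hle)).trans
      (ENNReal.Tendsto.const_mul ha (Or.inr ENNReal.coe_ne_top)).liminf_eq.le

lemma IsTestFunction.mono {n : ℕ} {F : Type*} [NormedAddCommGroup F] [NormedSpace ℝ F]
    {U V : Set (Space n)} {φ : Space n → F} (hφ : IsTestFunction U φ) (h : U ⊆ V) :
    IsTestFunction V φ :=
  ⟨hφ.smooth, hφ.compact, hφ.supp.trans h⟩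

lemma IsTestFunction.eLpNorm_restrict {n : ℕ} {U : Set (Space n)} {φ : Space n → ℝ}
    (hφ : IsTestFunction U φ) (p : ℝ≥0∞) :
    eLpNorm φ p (volume.restrict U) = eLpNorm φ p volume :=
  eLpNorm_restrict_eq_of_support_subset ((subset_tsupport φ).trans hφ.supp)

lemma IsTestFunction.eLpNorm_gradient_restrict {n : ℕ} {U : Set (Space n)} {φ : Space n → ℝ}
    (hφ : IsTestFunction U φ) (p : ℝ≥0∞) :
    eLpNorm (gradient φ) p (volume.restrict U) = eLpNorm (gradient φ) p volume :=
  eLpNorm_restrict_eq_of_support_subset fun x hx => hφ.supp <| by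
    by_contra hcon
    exact hx (gradient_eq_zero hcon)

lemma IsTestFunction.memW011 {n : ℕ} {U : Set (Space n)} {φ : Space n → ℝ}
    (hφ : IsTestFunction U φ) : MemW011 U φ (gradient φ) where
  memLp := (hφ.smooth.continuous.memLp_of_hasCompactSupport hφ.compact).restrict U
  memLp_grad := ((contDiff_gradient hφ.smooth).continuous.memLp_of_hasCompactSupport
    (hasCompactSupport_gradient hφ.compact)).restrict U
  weakGradient := by
    intro ψ hψ i
    have h0 : ∀ x ∉ U, φ x = 0 := fun x hx =>
      image_eq_zero_of_notMem_tsupport fun h => hx (hφ.supp h)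
    have h1 : ∀ x ∉ U, gradient φ x = 0 := fun x hx => gradient_eq_zero fun h => hx (hφ.supp h)
    rw [setIntegral_eq_integral_of_forall_compl_eq_zero fun x hx => by simp [h0 x hx],
      setIntegral_eq_integral_of_forall_compl_eq_zero fun x hx => by simp [h1 x hx],
      integral_mul_fderiv_eq_neg hφ.smooth hψ.smooth hψ.compact]
    simp_rw [gradient_apply]
  approx := ⟨fun _ => φ, fun _ => hφ, by simp, by simp⟩

/-- Every Sobolev constant for test functions is one for `W₀^{1,1}`. -/
lemma MemW011.eLpNorm_le {n : ℕ} {Ω : Set (Space n)} {C : ℝ≥0} {p : ℝ≥0∞}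
    (hC : ∀ φ : Space n → ℝ, IsTestFunction Ω φ →
      eLpNorm φ p (volume.restrict Ω) ≤ C * eLpNorm (gradient φ) 1 (volume.restrict Ω))
    {v : Space n → ℝ} {g : Space n → Space n} (hv : MemW011 Ω v g) :
    eLpNorm v p (volume.restrict Ω) ≤ C * eLpNorm g 1 (volume.restrict Ω) := by
  obtain ⟨φ, hφ, hlim, hlimg⟩ := hv.approx
  have hm : ∀ k, AEStronglyMeasurable (φ k) (volume.restrict Ω) := fun k =>
    (hφ k).smooth.continuous.aestronglyMeasurable
  -- `L¹` convergence gives almost everywhere convergence only along a subsequence, which is enough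
  -- for Fatou.
  obtain ⟨ns, hns, hae⟩ := (tendstoInMeasure_of_tendsto_eLpNorm one_ne_zero hm
    hv.memLp.aestronglyMeasurable hlim).exists_seq_tendsto_ae
  refine eLpNorm_le_of_tendsto (fun k => hm (ns k)) hae (fun k => ?_)
    (a := fun k => eLpNorm (fun x => gradient (φ (ns k)) x - g x) 1 (volume.restrict Ω)
      + eLpNorm g 1 (volume.restrict Ω)) ?_
  · refine (hC _ (hφ (ns k))).trans ?_
    gcongr
    have hgm : AEStronglyMeasurable (gradient (φ (ns k))) (volume.restrict Ω) :=
      (contDiff_gradient (hφ (ns k)).smooth).continuous.aestronglyMeasurable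
    refine le_trans (le_of_eq ?_) (eLpNorm_add_le (hgm.sub hv.memLp_grad.aestronglyMeasurable)
      hv.memLp_grad.aestronglyMeasurable le_rfl)
    congr 1
    ext1 x
    simp
  · have := (hlimg.comp hns.tendsto_atTop).add_const (eLpNorm g 1 (volume.restrict Ω))
    rwa [zero_add] at this

/-- The infimum is itself admissible for test functions: the set of constants is nonempty by
`exists_eLpNorm_le_gradient`, and dividing by the gradient norm passes the bound to the infimum. A
zero gradient norm is treated apart because of the division. -/
lemma le_embeddingConst_mul {n : ℕ} (hn : 1 ≤ n) {Ω : Set (Space n)} {φ : Space n → ℝ}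
    (hφ : IsTestFunction Ω φ) :
    eLpNorm φ (critExponent n) volume ≤ embeddingConst Ω * eLpNorm (gradient φ) 1 volume := by
  obtain ⟨C₀, hC₀⟩ := exists_eLpNorm_le_gradient hn
  set S := {C : ℝ≥0 | ∀ (v : Space n → ℝ) (g : Space n → Space n), MemW011 Ω v g →
    eLpNorm v (critExponent n) (volume.restrict Ω) ≤ C * eLpNorm g 1 (volume.restrict Ω)} with hS
  have hne : S.Nonempty := by
    refine ⟨C₀, fun v g hv => hv.eLpNorm_le fun ψ hψ => ?_⟩
    rw [hψ.eLpNorm_restrict, hψ.eLpNorm_gradient_restrict]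
    exact hC₀ ψ (hψ.mono (Set.subset_univ _))
  have hle : ∀ C ∈ S, eLpNorm φ (critExponent n) volume ≤ C * eLpNorm (gradient φ) 1 volume := by
    intro C hC
    have := hC φ _ hφ.memW011
    rwa [hφ.eLpNorm_restrict, hφ.eLpNorm_gradient_restrict] at this
  have hfin : eLpNorm (gradient φ) 1 volume ≠ ⊤ :=
    ((contDiff_gradient hφ.smooth).continuous.memLp_of_hasCompactSupport
      (hasCompactSupport_gradient hφ.compact)).eLpNorm_ne_top
  have hconst : (embeddingConst Ω : ℝ≥0∞) = ⨅ C ∈ S, (C : ℝ≥0∞) := ENNReal.coe_sInf hne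
  rcases eq_or_ne (eLpNorm (gradient φ) 1 volume) 0 with h0 | h0
  · have := hle _ hne.some_mem
    rw [h0, mul_zero] at this
    rw [h0, mul_zero]; exact this
  · rw [← ENNReal.div_le_iff h0 hfin, hconst]
    exact le_iInf₂ fun C hC => (ENNReal.div_le_iff h0 hfin).2 (hle C hC)

/-! ### Scale invariance and passage to `BV` -/

lemma map_smul_sub_volume {n : ℕ} {lam : ℝ} (hl : 0 < lam) (x₀ : Space n) :
    (volume : Measure (Space n)).map (fun y => lam • (y - x₀))
      = ENNReal.ofReal ((lam ^ n)⁻¹) • volume := by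
  have h1 : (fun y : Space n => lam • (y - x₀)) = (fun z => lam • z) ∘ (fun y => y - x₀) := rfl
  rw [h1, ← Measure.map_map (by fun_prop) (by fun_prop), map_sub_right_eq_self,
    Measure.map_addHaar_smul _ hl.ne', finrank_euclideanSpace_fin, abs_of_pos (by positivity)]

lemma eLpNorm_comp_smul_sub {n : ℕ} {F : Type*} [NormedAddCommGroup F] {f : Space n → F}
    (hf : Continuous f) {lam : ℝ} (hl : 0 < lam) (x₀ : Space n) (p : ℝ≥0∞) :
    eLpNorm (fun y => f (lam • (y - x₀))) p volume
      = ENNReal.ofReal ((lam ^ n)⁻¹) ^ (1 / p).toReal * eLpNorm f p volume := by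
  have h0 : ENNReal.ofReal ((lam ^ n)⁻¹) ≠ 0 := by
    rw [ne_eq, ENNReal.ofReal_eq_zero, not_le]; positivity
  have hm : AEMeasurable (fun y : Space n => lam • (y - x₀)) volume := by fun_prop
  rw [← smul_eq_mul, ← eLpNorm_smul_measure_of_ne_zero h0, ← map_smul_sub_volume hl x₀,
    eLpNorm_map_measure _ hm]
  · rfl
  · rw [map_smul_sub_volume hl x₀]
    exact hf.aestronglyMeasurable

/-- The Sobolev inequality in the critical exponent is scale invariant, so the embedding constant
of a nonempty open set controls all test functions on the whole space. -/
lemma eLpNorm_le_embeddingConst_mul {n : ℕ} (hn : 1 ≤ n) {Ω : Set (Space n)} (hΩ : IsOpen Ω)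
    (hne : Ω.Nonempty) {φ : Space n → ℝ} (hφ : IsTestFunction Set.univ φ) :
    eLpNorm φ (critExponent n) volume ≤ embeddingConst Ω * eLpNorm (gradient φ) 1 volume := by
  obtain ⟨x₀, hx₀⟩ := hne
  obtain ⟨s, hs, hball⟩ := Metric.isOpen_iff.1 hΩ x₀ hx₀
  obtain ⟨R, hR0, hR⟩ : ∃ R > 0, tsupport φ ⊆ Metric.ball (0 : Space n) R := by
    obtain ⟨R, hR⟩ := hφ.compact.isCompact.isBounded.subset_ball (0 : Space n)
    exact ⟨max R 1, by positivity, hR.trans (Metric.ball_subset_ball (le_max_left _ _))⟩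
  -- This dilation carries `ball x₀ s ⊆ Ω` onto `ball 0 R`, which contains the support of `φ`.
  set lam : ℝ := R / s with hlam
  have hl : 0 < lam := by positivity
  set A : Space n → Space n := fun y => lam • (y - x₀) with hA
  have hAs : ContDiff ℝ ∞ A := by fun_prop
  have hsupp : tsupport (φ ∘ A) ⊆ Metric.ball x₀ s := by
    intro y hy
    have h1 := hR (tsupport_comp_subset_preimage φ hAs.continuous hy)
    rw [mem_ball_zero_iff, norm_smul, Real.norm_of_nonneg hl.le] at h1
    rw [Metric.mem_ball, dist_eq_norm]
    have h2 : R = lam * s := by rw [hlam]; field_simp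
    rw [h2] at h1
    exact lt_of_mul_lt_mul_left h1 hl.le
  have htest : IsTestFunction Ω (φ ∘ A) :=
    ⟨hφ.smooth.comp hAs, Metric.isCompact_of_isClosed_isBounded (isClosed_tsupport _)
      (Metric.isBounded_ball.subset hsupp), hsupp.trans hball⟩
  have hgrad : gradient (φ ∘ A) = fun y => lam • gradient φ (A y) := by
    ext1 y
    have h1 : HasFDerivAt A (lam • ContinuousLinearMap.id ℝ (Space n)) y :=
      ((hasFDerivAt_id y).sub_const x₀).const_smul lam
    have h2 := ((hφ.smooth.differentiable (by simp) (A y)).hasFDerivAt.comp y h1).fderiv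
    simp only [gradient, h2]
    rw [← map_smul]
    congr 1
    ext w
    simp
  have hmain := le_embeddingConst_mul hn htest
  have hgnorm : eLpNorm (fun y => lam • gradient φ (A y)) 1 volume
      = ENNReal.ofReal lam * eLpNorm (fun y => gradient φ (A y)) 1 volume := by
    rw [show (fun y => lam • gradient φ (A y)) = lam • fun y => gradient φ (A y) from rfl,
      eLpNorm_const_smul, Real.enorm_eq_ofReal hl.le]
  rw [hgrad, hgnorm, eLpNorm_comp_smul_sub (contDiff_gradient hφ.smooth).continuous hl] at hmain
  have hφA : eLpNorm (φ ∘ A) (critExponent n) volume = _ :=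
    eLpNorm_comp_smul_sub hφ.smooth.continuous hl x₀ (critExponent n)
  have hn0 : (n : ℝ) ≠ 0 := by positivity
  -- Criticality of the exponent: both sides scale by `lam ^ (1 - n)`, so the factor cancels.
  have hc : ENNReal.ofReal ((lam ^ n)⁻¹) ^ (1 / critExponent n).toReal
      = ENNReal.ofReal lam * ENNReal.ofReal ((lam ^ n)⁻¹) := by
    rw [toReal_one_div_critExponent hn, ENNReal.ofReal_rpow_of_pos (by positivity),
      ← ENNReal.ofReal_mul hl.le, ← Real.rpow_natCast, ← Real.rpow_neg hl.le, ← Real.rpow_mul hl.le]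
    nth_rewrite 2 [← Real.rpow_one lam]
    rw [← Real.rpow_add hl]
    congr 2
    field_simp
    ring
  rw [hφA, hc] at hmain
  have h1 : (1 / (1 : ℝ≥0∞)).toReal = 1 := by simp
  rw [h1, ENNReal.rpow_one, ← mul_assoc (ENNReal.ofReal lam), mul_left_comm] at hmain
  refine (ENNReal.mul_le_mul_iff_right ?_ ?_).1 hmain
  · refine mul_ne_zero ?_ ?_ <;> rw [ne_eq, ENNReal.ofReal_eq_zero, not_le] <;> positivity
  · exact ENNReal.mul_ne_top ENNReal.ofReal_ne_top ENNReal.ofReal_ne_top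

/-- The Sobolev inequality for the zero extension of a `BV` function. -/
theorem eLpNorm_le_embeddingConst_mul_energyTV {n : ℕ} (hn : 1 ≤ n) {Ω : Set (Space n)}
    (hΩ : IsOpen Ω) (hbdd : Bornology.IsBounded Ω) {u : Space n → ℝ} (hu : MemBV Ω u)
    (hE : energyTV Ω u < ⊤) :
    eLpNorm u (critExponent n) (volume.restrict Ω) ≤ embeddingConst Ω * energyTV Ω u := by
  rcases Ω.eq_empty_or_nonempty with rfl | hne
  · simp
  rw [← eLpNorm_indicator_eq_eLpNorm_restrict hΩ.measurableSet]
  set f := Ω.indicator u with hf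
  have hfi : Integrable f := (integrable_indicator_iff hΩ.measurableSet).2 hu.integrable
  have hfc : HasCompactSupport f := HasCompactSupport.intro hbdd.isCompact_closure fun x hx =>
    Set.indicator_of_notMem (fun h => hx (subset_closure h)) _
  let ρ : ℕ → ContDiffBump (0 : Space n) := fun k =>
    ⟨1 / ((k : ℝ) + 1) / 2, 1 / ((k : ℝ) + 1), by positivity, half_lt_self (by positivity)⟩
  let v : ℕ → Space n → ℝ := fun k =>
    convolution ((ρ k).normed volume) f (ContinuousLinearMap.lsmul ℝ ℝ) volume
  have hv : ∀ k, IsTestFunction Set.univ (v k) := fun k =>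
    ⟨(ρ k).hasCompactSupport_normed.contDiff_convolution_left _ (ρ k).contDiff_normed
      hfi.locallyIntegrable, (ρ k).hasCompactSupport_normed.convolution _ hfc, Set.subset_univ _⟩
  have hlim : ∀ᵐ x, Tendsto (fun k => v k x) atTop (𝓝 (f x)) :=
    -- `K = 2` is the fixed ratio of outer to inner radius of the bumps.
    ContDiffBump.ae_convolution_tendsto_right_of_locallyIntegrable (K := 2)
      tendsto_one_div_add_atTop_nhds_zero_nat
      (Eventually.of_forall fun k => le_of_eq (by
        show 1 / ((k : ℝ) + 1) = 2 * (1 / ((k : ℝ) + 1) / 2); ring))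
      hfi.locallyIntegrable
  refine eLpNorm_le_of_tendsto (fun k => (hv k).smooth.continuous.aestronglyMeasurable) hlim
    (fun k => ?_) (a := fun _ => energyTV Ω u) tendsto_const_nhds
  refine (eLpNorm_le_embeddingConst_mul hn hΩ hne (hv k)).trans ?_
  gcongr
  have hgi : Integrable (gradient (v k)) :=
    (contDiff_gradient (hv k).smooth).continuous.integrable_of_hasCompactSupport
      (hasCompactSupport_gradient (hv k).compact)
  rw [eLpNorm_one_eq_lintegral_enorm, ← ofReal_integral_norm_eq_lintegral_enorm hgi]
  exact ENNReal.ofReal_le_of_le_toReal (integral_norm_gradient_le (hv k) fun φ hφ hφ1 =>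
    integral_convolution_mul_divergence_le hfi hE (ρ k) hφ hφ1)

/-! ### Interpolation and conclusion -/

/-- Interpolation between `L¹` and the critical exponent. -/
lemma eLpNorm_rpow_le_interpolation {n : ℕ} (hn : 1 ≤ n) {p : ℝ} (hp : 1 ≤ p)
    (hpn : ENNReal.ofReal p ≤ critExponent n) {μ : Measure (Space n)} {u : Space n → ℝ}
    (hu : AEStronglyMeasurable u μ) :
    eLpNorm u (ENNReal.ofReal p) μ ^ p ≤
      eLpNorm u 1 μ ^ (n - (n - 1) * p) * eLpNorm u (critExponent n) μ ^ ((p - 1) * n) := by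
  have hp0 : 0 < p := by linarith
  have hpow : eLpNorm u (ENNReal.ofReal p) μ ^ p = ∫⁻ x, ‖u x‖ₑ ^ p ∂μ := by
    have := eLpNorm_nnreal_pow_eq_lintegral (μ := μ) (f := u) (Real.toNNReal_pos.2 hp0).ne'
    rwa [Real.coe_toNNReal p hp0.le] at this
  rw [hpow]
  rcases hn.eq_or_lt with rfl | hn2
  -- For `n = 1` the critical norm is the essential supremum, and `|u|^p = |u| · |u|^(p - 1)`
  -- suffices.
  · rw [critExponent_one, eLpNorm_exponent_top, eLpNorm_one_eq_lintegral_enorm]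
    simp only [Nat.cast_one, sub_self, zero_mul, sub_zero, ENNReal.rpow_one, mul_one]
    rw [← lintegral_mul_const'' _ hu.enorm]
    refine lintegral_mono_ae ?_
    filter_upwards [ae_le_eLpNormEssSup (f := u) (μ := μ)] with x hx
    calc ‖u x‖ₑ ^ p = ‖u x‖ₑ ^ (1 + (p - 1)) := by ring_nf
      _ = ‖u x‖ₑ * ‖u x‖ₑ ^ (p - 1) := by
        rw [ENNReal.rpow_add_of_nonneg _ _ zero_le_one (by linarith), ENNReal.rpow_one]
      _ ≤ _ := by gcongr
  · have hn1 : (1 : ℝ) < n := by exact_mod_cast hn2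
    have hn1' : (1 : ℝ≥0) ≤ n := by exact_mod_cast hn
    set q : ℝ≥0 := (n : ℝ≥0) / ((n : ℝ≥0) - 1) with hq
    have hqr : (q : ℝ) = n / (n - 1) := by
      rw [hq, NNReal.coe_div, NNReal.coe_sub hn1']; simp
    have hq0 : (q : ℝ) ≠ 0 := by
      rw [hqr]; exact (div_pos (by linarith) (by linarith)).ne'
    rw [critExponent_eq_coe hn2] at hpn ⊢
    have hpq : p ≤ n / (n - 1) := by
      rw [← hqr]
      have := ENNReal.toReal_mono ENNReal.coe_ne_top hpn
      rwa [ENNReal.toReal_ofReal hp0.le] at this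
    rw [le_div_iff₀ (by linarith)] at hpq
    have ha : 0 ≤ (n : ℝ) - (n - 1) * p := by linarith
    have hb : 0 ≤ (p - 1) * ((n : ℝ) - 1) := mul_nonneg (by linarith) (by linarith)
    have hqb : (q : ℝ) * ((p - 1) * ((n : ℝ) - 1)) = (p - 1) * n := by
      rw [hqr]
      have : (n : ℝ) - 1 ≠ 0 := by linarith
      field_simp
    rw [← hqb, ENNReal.rpow_mul (eLpNorm u q μ), eLpNorm_nnreal_pow_eq_lintegral
      (fun h => hq0 (by rw [h]; rfl)), eLpNorm_one_eq_lintegral_enorm]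
    -- Hölder for `|u|` and `|u|^q` with weights `n - (n - 1) p` and `(p - 1)(n - 1)`, which sum to
    -- 1; the first is nonnegative exactly because `p ≤ q`.
    refine le_trans (le_of_eq ?_) (ENNReal.lintegral_mul_norm_pow_le hu.enorm
      (hu.enorm.pow_const _) ha hb (by ring))
    refine lintegral_congr fun x => ?_
    rw [← ENNReal.rpow_mul, hqb, ← ENNReal.rpow_add_of_nonneg _ _ ha
      (mul_nonneg (by linarith) (by linarith))]
    congr 1; ring

end BVEstimate

theorem corollary4p1 (n : ℕ) (hn : 1 ≤ n) (Ω : Set (BVEstimate.Space n))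
    (hΩ : IsOpen Ω) (hbdd : Bornology.IsBounded Ω) (hLip : BVEstimate.HasLipschitzBoundary Ω)
    (p : ℝ) (hp : 1 ≤ p) (hpn : ENNReal.ofReal p ≤ BVEstimate.critExponent n)
    (u : BVEstimate.Space n → ℝ) (hu : BVEstimate.MemBV Ω u) :
    BVEstimate.energyTV Ω u < ⊤ ∧
    eLpNorm u (ENNReal.ofReal p) (volume.restrict Ω) ^ p ≤
      (BVEstimate.embeddingConst Ω : ℝ≥0∞) ^ ((p - 1) * n) *
        eLpNorm u 1 (volume.restrict Ω) ^ (n - (n - 1) * p) *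
        BVEstimate.energyTV Ω u ^ ((p - 1) * n) ∧
    (p ≤ ((n : ℝ) + 1) / n →
      eLpNorm u (ENNReal.ofReal p) (volume.restrict Ω) ^ p ≤
        (BVEstimate.embeddingConst Ω : ℝ≥0∞) ^ ((p - 1) * n) *
          eLpNorm u 1 (volume.restrict Ω) ^ (n - (n - 1) * p) *
          (BVEstimate.energyTV Ω u + 1)) := by
  have hE := BVEstimate.energyTV_lt_top hΩ hbdd hLip hu
  have hpn0 : 0 ≤ (p - 1) * n := mul_nonneg (by linarith) (Nat.cast_nonneg n)
  have hmain : eLpNorm u (ENNReal.ofReal p) (volume.restrict Ω) ^ p ≤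
      (BVEstimate.embeddingConst Ω : ℝ≥0∞) ^ ((p - 1) * n) *
        eLpNorm u 1 (volume.restrict Ω) ^ (n - (n - 1) * p) *
        BVEstimate.energyTV Ω u ^ ((p - 1) * n) := by
    refine (BVEstimate.eLpNorm_rpow_le_interpolation hn hp hpn
      hu.memLp.aestronglyMeasurable).trans ?_
    rw [mul_comm ((BVEstimate.embeddingConst Ω : ℝ≥0∞) ^ ((p - 1) * n)), mul_assoc,
      ← ENNReal.mul_rpow_of_nonneg _ _ hpn0]
    gcongr
    exact BVEstimate.eLpNorm_le_embeddingConst_mul_energyTV hn hΩ hbdd hu hE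
  refine ⟨hE, hmain, fun hp2 => hmain.trans ?_⟩
  have hp1 : (p - 1) * n ≤ 1 := by
    rw [le_div_iff₀ (by exact_mod_cast hn)] at hp2
    linarith
  gcongr
  -- The base is first raised to at least 1, since only then does increasing the exponent to 1
  -- increase the power.
  calc BVEstimate.energyTV Ω u ^ ((p - 1) * n)
      ≤ (BVEstimate.energyTV Ω u + 1) ^ ((p - 1) * n) := by gcongr; exact le_self_add
    _ ≤ (BVEstimate.energyTV Ω u + 1) ^ (1 : ℝ) :=
        ENNReal.rpow_le_rpow_of_exponent_le le_add_self hp1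
    _ = BVEstimate.energyTV Ω u + 1 := ENNReal.rpow_one _
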